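/- An $(n,t,\lambda)$-graph is a (finite, simple) $t$-regular graph on $n$ vertices whose second largest absolute adjacency eigenvalue is at most $\lambda$; that is, if $\mu_1\ge\mu_2\ge\dots\ge\mu_n$ are the eigenvalues of the adjacency matrix, listed with multiplicity, then $|\mu_i|\le\lambda$ for every $2\le i\le n$. For every $D\in\mathbb{N}$ there exist an integer $t\ge 1$ and a real $\varepsilon>0$ such that the following holds. Let $G$ be an $(n,t,3\sqrt t)$-graph, and let $T$ be a tree with $v(T)\le n/(3t)$ vertices and maximum degree $\Delta(T)\le D$. Then for any family of subsets $\{S_v\subseteq V(G)\}_{v\in V(T)}$ with $|S_v|\ge(1-\varepsilon)n$ for each $v\in V(T)$, there exists an embedding $\phi\colon T\to G$ (an injective map $V(T)\to V(G)$ sending edges of $T$ to edges of $G$) such that $\phi(v)\in S_v$ for every $v\in V(T)$. -/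

import Mathlib

/-- `G` is an `(n, t, lam)`-graph: a `t`-regular graph on `n` vertices whose second largest absolute
eigenvalue is at most `lam`. The eigenvalues `μ₀ ≥ μ₁ ≥ ⋯ ≥ μ_{n-1}` of the adjacency matrix are
listed with multiplicity (`eigenvalues₀` is antitone). For a `t`-regular graph `μ₀ = t` is also the
largest eigenvalue in absolute value, so the second largest absolute eigenvalue is the maximum of
`|μ_i|` over `i ≥ 1`, that is, `max (|μ₁|, |μ_{n-1}|)`. -/
structure SimpleGraph.IsNTLambda {V : Type*} [Fintype V] [DecidableEq V] (G : SimpleGraph V)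
    [DecidableRel G.Adj] (n t : ℕ) (lam : ℝ) : Prop where
  card_eq : Fintype.card V = n
  regular : G.IsRegularOfDegree t
  abs_eigenvalue_le : ∀ i : Fin (Fintype.card V), i.val ≠ 0 →
    |(G.isHermitian_adjMatrix ℝ).eigenvalues₀ i| ≤ lam

/-! The tree is embedded leaf by leaf, in the manner of Friedman and Pippenger. Every vertex demands
free neighbours: `D` for the tree edges it may have to carry and `q` more to absorb those neighbours
that the next list forbids. As long as the Hall-type condition `Extendable` holds, expansion allows
another leaf to be placed with the condition preserved (`exists_extension`).

A list can fail locally, when the image of `u` has too many neighbours forbidden for a neighbour `w`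
of `u`. By the spectral gap this happens at few vertices for any one small forbidden set. Forbidding
those vertices for `u` as well, and closing under this rule, keeps the forbidden sets small
(`exists_closed_forbidden`); afterwards every allowed image has at most `q` bad neighbours. Both
this count and the expansion follow from the variance bound `sum_sq_card_inter_sub_le`. -/

/-- A set `U` of occupied vertices together with demands `c` is *extendable* if every set of at most
`r` vertices has enough unoccupied neighbours to meet its total demand. -/
def SimpleGraph.Extendable {V : Type*} [Fintype V] [DecidableEq V] (G : SimpleGraph V)
    [DecidableRel G.Adj] (r : ℕ) (U : Finset V) (c : V → ℕ) : Prop :=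
  ∀ X : Finset V, X.card ≤ r → ∑ x ∈ X, c x ≤ (X.biUnion (G.neighborFinset ·) \ U).card

/-! ### Occupying one more vertex: tight sets and uncrossing -/

section Extension

variable {V : Type*} [Fintype V] [DecidableEq V] {G : SimpleGraph V} [DecidableRel G.Adj]

/-- Sets whose demand is met exactly are closed under unions. -/
theorem SimpleGraph.Extendable.tight_union {r : ℕ} {U : Finset V} {c : V → ℕ}
    (h : G.Extendable r U c) {X Y : Finset V} (hr : (X ∪ Y).card ≤ r)
    (hX : (X.biUnion (G.neighborFinset ·) \ U).card = ∑ x ∈ X, c x)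
    (hY : (Y.biUnion (G.neighborFinset ·) \ U).card = ∑ x ∈ Y, c x) :
    ((X ∪ Y).biUnion (G.neighborFinset ·) \ U).card = ∑ x ∈ X ∪ Y, c x := by
  -- Demand is modular and the number of free neighbours is submodular, so equality at `X` and `Y`,
  -- with the lower bounds at `X ∪ Y` and `X ∩ Y`, forces equality at the union.
  have h1 := h _ hr
  have h2 := h (X ∩ Y) ((Finset.card_le_card
    (Finset.inter_subset_left.trans Finset.subset_union_left)).trans hr)
  have h3 := Finset.sum_union_inter (s₁ := X) (s₂ := Y) (f := c)
  have h4 := Finset.card_union_add_card_inter (X.biUnion (G.neighborFinset ·) \ U)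
    (Y.biUnion (G.neighborFinset ·) \ U)
  have h5 : (X ∪ Y).biUnion (G.neighborFinset ·) \ U =
      (X.biUnion (G.neighborFinset ·) \ U) ∪ (Y.biUnion (G.neighborFinset ·) \ U) := by
    rw [Finset.union_biUnion, Finset.union_sdiff_distrib]
  have h6 : ((X ∩ Y).biUnion (G.neighborFinset ·) \ U).card ≤
      ((X.biUnion (G.neighborFinset ·) \ U) ∩ (Y.biUnion (G.neighborFinset ·) \ U)).card := by
    apply Finset.card_le_card
    intro z
    simp only [Finset.mem_sdiff, Finset.mem_biUnion, Finset.mem_inter]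
    grind
  rw [h5] at h1 ⊢
  omega

/-- If all sets of size between `m` and `2 * m` have slack, a vertex `x` whose demand exceeds the
number of its neighbours outside `L` has a neighbour in `L` that can be occupied next. -/
theorem SimpleGraph.Extendable.exists_extension {m q : ℕ} (hm : 0 < m) {U L : Finset V} {c : V → ℕ}
    (h : G.Extendable (2 * m) U c)
    (hslack : ∀ X : Finset V, m < X.card → X.card ≤ 2 * m →
      ∑ x ∈ X, c x < (X.biUnion (G.neighborFinset ·) \ U).card)
    {x : V} (hx : q < c x) (hL : (G.neighborFinset x \ L).card ≤ q) :
    ∃ y ∈ L, G.Adj x y ∧ y ∉ U ∧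
      G.Extendable (2 * m) (insert y U) (Function.update c x (c x - 1)) := by
  by_contra! hno
  -- If no candidate works, each one lies in the neighbourhood of a tight set avoiding `x`. Uniting
  -- these blocking sets gives a single tight set that sees every candidate.
  have key : ∀ Y : Finset V, Y ⊆ (G.neighborFinset x ∩ L) \ U → ∃ X : Finset V, X.card ≤ m ∧ x ∉ X ∧
      (X.biUnion (G.neighborFinset ·) \ U).card = ∑ x ∈ X, c x ∧ Y ⊆ X.biUnion (G.neighborFinset ·) := by
    intro Y
    induction Y using Finset.induction_on with
    | empty => exact fun _ => ⟨∅, by simp⟩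
    | insert y Y hy ih =>
      intro hsub
      obtain ⟨X₁, hc₁, hx₁, ht₁, hY₁⟩ := ih ((Finset.subset_insert _ _).trans hsub)
      have hymem := hsub (Finset.mem_insert_self y Y)
      simp only [Finset.mem_sdiff, Finset.mem_inter, SimpleGraph.mem_neighborFinset] at hymem
      have hbad := hno y hymem.1.2 hymem.1.1 hymem.2
      simp only [SimpleGraph.Extendable, not_forall, not_le] at hbad
      obtain ⟨X₂, hc₂, hlt⟩ := hbad
      have hg := h X₂ hc₂
      have hle : (X₂.biUnion (G.neighborFinset ·) \ U).card ≤
          (X₂.biUnion (G.neighborFinset ·) \ insert y U).card + 1 := by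
        rw [Finset.sdiff_insert]
        have := Finset.pred_card_le_card_erase (s := X₂.biUnion (G.neighborFinset ·) \ U) (a := y)
        omega
      -- If `x` were in `X₂`, its demand would drop by one, paying for the loss of `y`.
      have hx₂ : x ∉ X₂ := by
        intro hmem
        rw [Finset.sum_update_of_mem hmem] at hlt
        rw [← Finset.add_sum_erase _ _ hmem, ← Finset.sdiff_singleton_eq_erase] at hg
        omega
      rw [Finset.sum_update_of_notMem hx₂] at hlt
      have hy₂ : y ∈ X₂.biUnion (G.neighborFinset ·) := by
        by_contra hy₂
        rw [Finset.sdiff_insert, Finset.erase_eq_of_notMem] at hlt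
        · omega
        · exact fun hh => hy₂ (Finset.mem_sdiff.1 hh).1
      have ht₂ : (X₂.biUnion (G.neighborFinset ·) \ U).card = ∑ x ∈ X₂, c x := by omega
      have small : ∀ X : Finset V, X.card ≤ 2 * m →
          (X.biUnion (G.neighborFinset ·) \ U).card = ∑ x ∈ X, c x → X.card ≤ m := by
        intro X hX hXt
        by_contra! hlt'
        exact absurd (hslack X hlt' hX) (by omega)
      -- Slack confines tight sets to size `m`, so a union of two stays within `2 * m`, is tight,
      -- and hence again has size at most `m`.
      have hu : (X₁ ∪ X₂).card ≤ 2 * m := by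
        have := Finset.card_union_le X₁ X₂
        have := small _ hc₂ ht₂
        omega
      have ht := h.tight_union hu ht₁ ht₂
      refine ⟨X₁ ∪ X₂, small _ hu ht, by simp [hx₁, hx₂], ht, ?_⟩
      rw [Finset.union_biUnion]
      exact Finset.insert_subset (Finset.mem_union_right _ hy₂)
        (hY₁.trans Finset.subset_union_left)
  obtain ⟨X, hXc, hxX, ht, hsub⟩ := key _ subset_rfl
  have hg := h (insert x X) (by rw [Finset.card_insert_of_notMem hxX]; omega)
  rw [Finset.sum_insert hxX] at hg
  -- All free neighbours of `x` in `L` are already seen by `X`, so adding `x` gains at most `q` free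
  -- vertices while the demand grows by `c x > q`.
  have hle : ((insert x X).biUnion (G.neighborFinset ·) \ U).card ≤
      (X.biUnion (G.neighborFinset ·) \ U).card + (G.neighborFinset x \ L).card := by
    refine (Finset.card_le_card ?_).trans (Finset.card_union_le _ _)
    intro z hz
    have := @hsub z
    simp only [Finset.mem_sdiff, Finset.mem_union, Finset.mem_inter,
      Finset.biUnion_insert] at *
    tauto
  omega

end Extension

/-! ### Leaf-by-leaf embedding with lists -/

/-- Embedding a tree with one list per vertex into an expanding graph: every image of `u` outside
its forbidden set `B u` has few neighbours in the forbidden sets of the neighbours of `u`. -/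
theorem SimpleGraph.exists_extendable_embedding.{u, v} {V : Type u} [Fintype V] [DecidableEq V]
    {G : SimpleGraph V} [DecidableRel G.Adj] {m q D M : ℕ} (hm : 0 < m)
    (hexp : ∀ X : Finset V, X.Nonempty → X.card ≤ 2 * m →
      (q + D) * X.card + 1 ≤ (X.biUnion (G.neighborFinset ·)).card)
    (hexp' : ∀ X : Finset V, m < X.card → X.card ≤ 2 * m →
      (q + D) * X.card + M < (X.biUnion (G.neighborFinset ·)).card) (k : ℕ) :
    ∀ (W : Type v) [Fintype W] (T : SimpleGraph W) [DecidableRel T.Adj] (B : W → Finset V),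
      Fintype.card W = k + 1 → k + 1 ≤ M → T.IsTree → (∀ w, T.degree w ≤ D) →
      (∀ w, ∃ x, x ∉ B w) →
      (∀ w w', T.Adj w w' → ∀ x, x ∉ B w → (G.neighborFinset x ∩ B w').card ≤ q) →
      ∃ (φ : W → V) (c : V → ℕ), Function.Injective φ ∧ (∀ w w', T.Adj w w' → G.Adj (φ w) (φ w')) ∧
        (∀ w, φ w ∉ B w) ∧ G.Extendable (2 * m) (Finset.univ.image φ) c ∧ (∀ x, c x ≤ q + D) ∧
        (∀ x, x ∉ Finset.univ.image φ → c x = q + D) ∧ ∀ w, q + D ≤ c (φ w) + T.degree w := by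
  induction k with
  | zero =>
    intro W _ T _ B hcard _ _ _ hne _
    have : Subsingleton W := Fintype.card_le_one_iff_subsingleton.1 (by omega)
    choose f hf using hne
    refine ⟨f, fun _ => q + D, Function.injective_of_subsingleton f,
      fun w w' hww => absurd (Subsingleton.elim w w') hww.ne, hf, ?_, fun _ => le_rfl,
      fun _ _ => rfl, fun _ => Nat.le_add_right _ _⟩
    intro X hX
    rcases X.eq_empty_or_nonempty with rfl | hXne
    · simp
    -- The `+ 1` in `hexp` pays for the single occupied vertex.
    · have h1 := hexp X hXne hX
      have h2 := Finset.le_card_sdiff (Finset.univ.image f) (X.biUnion (G.neighborFinset ·))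
      have h3 : (Finset.univ.image f).card ≤ 1 := Finset.card_image_le.trans (by simp [hcard])
      rw [Finset.sum_const, smul_eq_mul, mul_comm]
      omega
  | succ k ih =>
    intro W _ T _ B hcard hM hT hdeg hne hB
    classical
    have : Nontrivial W := Fintype.one_lt_card_iff_nontrivial.1 (by omega)
    obtain ⟨v, hv⟩ := hT.exists_vert_degree_one_of_nontrivial
    obtain ⟨u, huv, huniq⟩ := SimpleGraph.degree_eq_one_iff_existsUnique_adj.1 hv
    have huv' : u ≠ v := huv.ne'
    let T' := T.induce ({v}ᶜ : Set W)
    have hdle : ∀ w : ({v}ᶜ : Set W), T'.degree w + (if T.Adj w v then 1 else 0) ≤ T.degree w := by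
      intro w
      have hmap : ((T'.neighborFinset w).map (Function.Embedding.subtype _)) ⊆
          (T.neighborFinset w).erase v := by
        intro z hz
        simp only [Finset.mem_map, SimpleGraph.mem_neighborFinset,
          Function.Embedding.subtype_apply] at hz
        obtain ⟨a, ha, rfl⟩ := hz
        exact Finset.mem_erase.2 ⟨a.2, by simpa [T'] using ha⟩
      have h1 := Finset.card_le_card hmap
      rw [Finset.card_map, SimpleGraph.card_neighborFinset_eq_degree] at h1
      split_ifs with hadj
      · rw [Finset.card_erase_of_mem (by simpa using hadj),
          SimpleGraph.card_neighborFinset_eq_degree] at h1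
        have : 0 < T.degree w := (T.degree_pos_iff_exists_adj _).2 ⟨v, hadj⟩
        omega
      · rw [Finset.erase_eq_of_notMem (by simpa using hadj),
          SimpleGraph.card_neighborFinset_eq_degree] at h1
        omega
    obtain ⟨φ, c, hinj, hhom, hlist, hext, hcle, hcoff, hcon⟩ := ih ({v}ᶜ : Set W) T'
      (fun w => B w) (by rw [Fintype.card_compl_set]; simp [hcard]) (by omega)
      ⟨hT.connected.induce_compl_singleton_of_degree_eq_one hv, hT.isAcyclic.induce _⟩
      (fun w => by have := hdle w; have := hdeg w; omega) (fun w => hne w)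
      (fun w w' hww x hx => hB w w' (by simpa [T'] using hww) x hx)
    let u' : ({v}ᶜ : Set W) := ⟨u, huv'⟩
    -- Without `v`, the degree of `u` is at most `D - 1`, so more than `q` of its demand remains.
    have hcu : q < c (φ u') := by
      have h1 := hcon u'
      have h2 := hdle u'
      rw [if_pos huv.symm] at h2
      have h3 : T.degree u' ≤ D := hdeg u
      omega
    have hUcard : (Finset.univ.image φ).card ≤ M :=
      Finset.card_image_le.trans (by
        rw [Finset.card_univ, Fintype.card_compl_set]
        simp [hcard]
        omega)
    have hslack : ∀ X : Finset V, m < X.card → X.card ≤ 2 * m →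
        ∑ x ∈ X, c x < (X.biUnion (G.neighborFinset ·) \ Finset.univ.image φ).card := by
      intro X h1 h2
      have h3 := hexp' X h1 h2
      have h4 := Finset.le_card_sdiff (Finset.univ.image φ) (X.biUnion (G.neighborFinset ·))
      have h5 : ∑ x ∈ X, c x ≤ X.card * (q + D) := by
        simpa using Finset.sum_le_card_nsmul X c (q + D) fun x _ => hcle x
      rw [mul_comm] at h5
      omega
    obtain ⟨y, hyL, hadj, hyU, hext'⟩ := hext.exists_extension hm hslack hcu
      (L := (B v)ᶜ) (by
        rw [sdiff_compl]
        exact hB u v huv.symm _ (hlist u'))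
    let ψ : W → V := fun w => if h : w = v then y else φ ⟨w, h⟩
    have hψv : ψ v = y := by simp [ψ]
    have hψ : ∀ w (h : w ≠ v), ψ w = φ ⟨w, h⟩ := fun w h => by simp [ψ, h]
    have hyφ : ∀ w, φ w ≠ y := fun w h => hyU (Finset.mem_image.2 ⟨w, Finset.mem_univ _, h⟩)
    have himage : Finset.univ.image ψ = insert y (Finset.univ.image φ) := by
      ext z
      simp only [Finset.mem_image, Finset.mem_univ, true_and, Finset.mem_insert]
      constructor
      · rintro ⟨w, rfl⟩
        by_cases h : w = v
        · exact Or.inl (by rw [h, hψv])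
        · exact Or.inr ⟨_, (hψ w h).symm⟩
      · rintro (rfl | ⟨w, rfl⟩)
        · exact ⟨v, hψv⟩
        · exact ⟨w, hψ w w.2⟩
    refine ⟨ψ, Function.update c (φ u') (c (φ u') - 1), ?_, ?_, ?_, ?_, ?_, ?_, ?_⟩
    · intro a b hab
      by_cases ha : a = v <;> by_cases hb : b = v
      · rw [ha, hb]
      · rw [ha, hψv, hψ b hb] at hab
        exact absurd hab.symm (hyφ _)
      · rw [hb, hψv, hψ a ha] at hab
        exact absurd hab (hyφ _)
      · rw [hψ a ha, hψ b hb] at hab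
        exact congrArg Subtype.val (hinj hab)
    · intro a b hab
      by_cases ha : a = v
      · subst ha
        obtain rfl := huniq b hab
        rw [hψv, hψ b huv']
        exact hadj.symm
      · by_cases hb : b = v
        · subst hb
          obtain rfl := huniq a hab.symm
          rw [hψv, hψ a huv']
          exact hadj
        · rw [hψ a ha, hψ b hb]
          exact hhom _ _ (by simpa [T'] using hab)
    · intro w
      by_cases hw : w = v
      · rw [hw, hψv]
        exact Finset.mem_compl.1 hyL
      · rw [hψ w hw]
        exact hlist _
    · rw [himage]
      exact hext'
    · intro x
      by_cases hx : x = φ u'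
      · rw [hx, Function.update_self]
        exact (Nat.sub_le _ _).trans (hcle _)
      · rw [Function.update_of_ne hx]
        exact hcle x
    · intro x hx
      rw [himage, Finset.mem_insert, not_or] at hx
      rw [Function.update_of_ne]
      · exact hcoff x hx.2
      · rintro rfl
        exact hx.2 (Finset.mem_image_of_mem _ (Finset.mem_univ _))
    · intro w
      by_cases hw : w = v
      · rw [hw, hψv, Function.update_of_ne (hyφ u').symm, hcoff y hyU]
        exact Nat.le_add_right _ _
      · rw [hψ w hw]
        have h1 := hcon ⟨w, hw⟩
        have h2 := hdle ⟨w, hw⟩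
        by_cases hwu : w = u
        · subst hwu
          rw [Function.update_self]
          rw [if_pos huv.symm] at h2
          dsimp only at h2
          have h3 : φ u' = φ ⟨w, hw⟩ := rfl
          rw [h3] at hcu ⊢
          omega
        · rw [Function.update_of_ne]
          · dsimp only at h2
            omega
          · intro h
            exact hwu (congrArg Subtype.val (hinj h))


/-! ### Spectral estimates: degree variance and expansion -/

section Spectral

open Matrix

theorem Matrix.IsHermitian.dotProduct_eigenvectorBasis_mulVec {n : Type*} [Fintype n]
    [DecidableEq n] {A : Matrix n n ℝ} (hA : A.IsHermitian) (j : n) (v : n → ℝ) :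
    ⇑(hA.eigenvectorBasis j) ⬝ᵥ (A *ᵥ v) = hA.eigenvalues j * (⇑(hA.eigenvectorBasis j) ⬝ᵥ v) := by
  have hT : Aᵀ = A := by simpa [Matrix.IsHermitian] using hA
  rw [Matrix.dotProduct_mulVec, ← Matrix.mulVec_transpose, hT, hA.mulVec_eigenvectorBasis,
    smul_dotProduct, smul_eq_mul]

theorem Matrix.IsHermitian.sum_dotProduct_eigenvectorBasis_mul {n : Type*} [Fintype n]
    [DecidableEq n] {A : Matrix n n ℝ} (hA : A.IsHermitian) (v w : n → ℝ) :
    ∑ j, (⇑(hA.eigenvectorBasis j) ⬝ᵥ v) * (⇑(hA.eigenvectorBasis j) ⬝ᵥ w) = v ⬝ᵥ w := by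
  have h := hA.eigenvectorBasis.sum_inner_mul_inner (WithLp.toLp 2 v) (WithLp.toLp 2 w)
  simp only [EuclideanSpace.inner_eq_star_dotProduct, star_trivial] at h
  rw [dotProduct_comm v w, ← h]
  exact Finset.sum_congr rfl fun j _ => by rw [dotProduct_comm _ w]

variable {V : Type*} [Fintype V] [DecidableEq V] {G : SimpleGraph V} [DecidableRel G.Adj]
  {n t : ℕ} {lam : ℝ}

/-- The adjacency matrix of an `(n, t, lam)`-graph contracts vectors orthogonal to the constants. -/
theorem SimpleGraph.IsNTLambda.adjMatrix_mulVec_dotProduct_self_le (h : G.IsNTLambda n t lam)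
    (hlam : lam < t) {f : V → ℝ} (hf : ∑ x, f x = 0) :
    (G.adjMatrix ℝ *ᵥ f) ⬝ᵥ (G.adjMatrix ℝ *ᵥ f) ≤ lam ^ 2 * (f ⬝ᵥ f) := by
  set hA := G.isHermitian_adjMatrix ℝ
  -- This is the bijection through which `eigenvalues` is defined from `eigenvalues₀`; index `0` is
  -- the largest eigenvalue.
  let idx : V ≃ Fin (Fintype.card V) := (Fintype.equivOfCardEq (Fintype.card_fin _)).symm
  have hμ : ∀ j, (idx j).val ≠ 0 → |hA.eigenvalues j| ≤ lam := fun j hj =>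
    h.abs_eigenvalue_le _ hj
  have hone : G.adjMatrix ℝ *ᵥ (fun _ => 1) = (t : ℝ) • (fun _ => (1 : ℝ)) := by
    ext x
    have := G.adjMatrix_mulVec_const_apply_of_regular (a := (1 : ℝ)) h.regular (v := x)
    simpa [Function.const] using this
  have horth : ∀ j, (idx j).val ≠ 0 → ⇑(hA.eigenvectorBasis j) ⬝ᵥ (fun _ => (1 : ℝ)) = 0 := by
    intro j hj
    have h1 := hA.dotProduct_eigenvectorBasis_mulVec j (fun _ => 1)
    rw [hone, dotProduct_smul, smul_eq_mul] at h1
    have h2 := (le_abs_self _).trans (hμ j hj)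
    have h3 : ((t : ℝ) - hA.eigenvalues j) *
        (⇑(hA.eigenvectorBasis j) ⬝ᵥ (fun _ => (1 : ℝ))) = 0 := by linarith
    rcases mul_eq_zero.1 h3 with h4 | h4
    · linarith
    · exact h4
  -- By `horth` the constants are spanned by the eigenvector of index `0`, so a vector orthogonal to
  -- them has no component along it.
  have hzero : ∀ j, (idx j).val = 0 → ⇑(hA.eigenvectorBasis j) ⬝ᵥ f = 0 := by
    intro j hj
    have hne : ∀ i, i ≠ j → (idx i).val ≠ 0 := fun i hi h0 =>
      hi (idx.injective (Fin.ext (h0.trans hj.symm)))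
    have h1 := hA.sum_dotProduct_eigenvectorBasis_mul (fun _ => 1) f
    have h2 := hA.sum_dotProduct_eigenvectorBasis_mul (fun _ => 1) (fun _ => 1)
    rw [Finset.sum_eq_single j (fun i _ hi => by rw [horth i (hne i hi), zero_mul])
      (fun hj => absurd (Finset.mem_univ _) hj)] at h1 h2
    have h3 : (fun _ : V => (1 : ℝ)) ⬝ᵥ f = 0 := by simpa [dotProduct] using hf
    rw [h3] at h1
    rcases mul_eq_zero.1 h1 with h4 | h4
    · rw [h4] at h2
      have : (0 : ℝ) < Fintype.card V := by
        exact_mod_cast Fintype.card_pos_iff.2 ⟨j⟩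
      simp only [dotProduct, mul_one, Finset.sum_const, Finset.card_univ, nsmul_eq_mul] at h2
      linarith
    · exact h4
  rw [← hA.sum_dotProduct_eigenvectorBasis_mul, ← hA.sum_dotProduct_eigenvectorBasis_mul f f,
    Finset.mul_sum]
  refine Finset.sum_le_sum fun j _ => ?_
  rw [hA.dotProduct_eigenvectorBasis_mulVec]
  by_cases hj : (idx j).val = 0
  · simp [hzero j hj]
  · have h1 : hA.eigenvalues j ^ 2 ≤ lam ^ 2 := sq_le_sq' (abs_le.1 (hμ j hj)).1
      (abs_le.1 (hμ j hj)).2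
    nlinarith [mul_le_mul_of_nonneg_right h1 (mul_self_nonneg (⇑(hA.eigenvectorBasis j) ⬝ᵥ f))]

/-- The degrees into a set `B` of an `(n, t, lam)`-graph deviate little from their average. -/
theorem SimpleGraph.IsNTLambda.sum_sq_card_inter_sub_le (h : G.IsNTLambda n t lam)
    (hlam : lam < t) (B : Finset V) :
    ∑ x, (((G.neighborFinset x ∩ B).card : ℝ) - t * B.card / n) ^ 2 ≤ lam ^ 2 * B.card := by
  rcases isEmpty_or_nonempty V with hV | hV
  · simp
    positivity
  have hn : (0 : ℝ) < n := by
    rw [← h.card_eq]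
    exact_mod_cast Fintype.card_pos
  -- The centred indicator of `B`: the adjacency matrix maps it to the deviations to be bounded.
  let f : V → ℝ := fun x => (if x ∈ B then 1 else 0) - B.card / n
  have hf : ∑ x, f x = 0 := by
    simp only [f, Finset.sum_sub_distrib, Finset.sum_const, Finset.card_univ, h.card_eq,
      nsmul_eq_mul, Finset.sum_ite_mem, Finset.univ_inter]
    field_simp
    ring
  have hff : f ⬝ᵥ f ≤ B.card := by
    have h1 : f ⬝ᵥ f = ∑ x, ((if x ∈ B then (1 : ℝ) else 0) - B.card / n * f x
        - B.card / n * (if x ∈ B then (1 : ℝ) else 0)) := by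
      refine Finset.sum_congr rfl fun x _ => ?_
      simp only [f]
      split_ifs <;> ring
    rw [h1, Finset.sum_sub_distrib, Finset.sum_sub_distrib, ← Finset.mul_sum, ← Finset.mul_sum, hf]
    simp only [Finset.sum_ite_mem, Finset.univ_inter, Finset.sum_const, nsmul_eq_mul]
    have : 0 ≤ (B.card : ℝ) / n * B.card := by positivity
    linarith
  have hAf : ∀ x, (G.adjMatrix ℝ *ᵥ f) x =
      ((G.neighborFinset x ∩ B).card : ℝ) - t * B.card / n := by
    intro x
    rw [SimpleGraph.adjMatrix_mulVec_apply]
    simp only [f, Finset.sum_sub_distrib, Finset.sum_const, Finset.sum_ite_mem,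
      SimpleGraph.card_neighborFinset_eq_degree, h.regular.degree_eq x, nsmul_eq_mul]
    ring
  have key := h.adjMatrix_mulVec_dotProduct_self_le hlam hf
  have h2 : (G.adjMatrix ℝ *ᵥ f) ⬝ᵥ (G.adjMatrix ℝ *ᵥ f) =
      ∑ x, (((G.neighborFinset x ∩ B).card : ℝ) - t * B.card / n) ^ 2 :=
    Finset.sum_congr rfl fun x _ => by rw [hAf, sq]
  rw [← h2]
  exact key.trans (mul_le_mul_of_nonneg_left hff (sq_nonneg _))

/-- Few vertices send more than their share of edges into a small set. -/
theorem SimpleGraph.IsNTLambda.card_filter_mul_sq_le (h : G.IsNTLambda n t lam)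
    (hlam : lam < t) (B : Finset V) {q : ℕ} {d : ℝ} (hd : 0 ≤ d)
    (hq : d + t * B.card / n ≤ q) :
    ((Finset.univ.filter fun x => q < (G.neighborFinset x ∩ B).card).card : ℝ) * d ^ 2 ≤
      lam ^ 2 * B.card := by
  -- Chebyshev: each counted vertex contributes at least `d ^ 2` to the sum of squares.
  refine le_trans ?_ (h.sum_sq_card_inter_sub_le hlam B)
  rw [← nsmul_eq_mul]
  refine (Finset.card_nsmul_le_sum _ _ _ fun x hx => ?_).trans
    (Finset.sum_le_sum_of_subset_of_nonneg (Finset.subset_univ _) fun _ _ _ => sq_nonneg _)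
  have h1 : (q : ℝ) < (G.neighborFinset x ∩ B).card := by
    exact_mod_cast (Finset.mem_filter.1 hx).2
  exact pow_le_pow_left₀ hd (by linarith) 2

/-- Small sets of an `(n, t, lam)`-graph expand. -/
theorem SimpleGraph.IsNTLambda.card_mul_sq_le (h : G.IsNTLambda n t lam) (hn : 0 < n)
    (hlam : lam < t) {X : Finset V} (hX : X.Nonempty) :
    (t : ℝ) ^ 2 * X.card ≤ (X.biUnion (G.neighborFinset ·)).card *
      (lam ^ 2 + t ^ 2 * X.card / n) := by
  have hn' : (0 : ℝ) < n := by exact_mod_cast hn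
  have hXpos : (0 : ℝ) < X.card := by exact_mod_cast hX.card_pos
  set N := X.biUnion (G.neighborFinset ·)
  let g : V → ℝ := fun x => (G.neighborFinset x ∩ X).card
  have hsum : ∑ x, g x = t * X.card := by
    -- The function `g` has total `t * X.card` and lives on `N`. Cauchy–Schwarz against its second
    -- moment, known from the variance bound, makes `N` large.
    have h1 : ∀ x, g x = ∑ y ∈ X, if G.Adj x y then (1 : ℝ) else 0 := by
      intro x
      simp only [g, Finset.sum_boole]
      congr 2
      ext y
      simp [and_comm]
    simp only [h1]
    rw [Finset.sum_comm]
    have h2 : ∀ y, (∑ x, if G.Adj x y then (1 : ℝ) else 0) = t := by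
      intro y
      rw [Finset.sum_boole, ← h.regular.degree_eq y, ← SimpleGraph.card_neighborFinset_eq_degree]
      congr 2
      ext x
      simp [SimpleGraph.adj_comm]
    simp [h2, mul_comm]
  have hsupp : ∑ x ∈ N, g x = ∑ x, g x := by
    refine Finset.sum_subset (Finset.subset_univ _) fun x _ hx => ?_
    simp only [g, Nat.cast_eq_zero, Finset.card_eq_zero]
    ext y
    simp only [Finset.mem_inter, SimpleGraph.mem_neighborFinset, Finset.notMem_empty, iff_false]
    rintro ⟨hxy, hy⟩
    exact hx (Finset.mem_biUnion.2 ⟨y, hy, by simpa using hxy.symm⟩)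
  have hsq : ∑ x, g x ^ 2 ≤ lam ^ 2 * X.card + t ^ 2 * X.card ^ 2 / n := by
    have h1 := h.sum_sq_card_inter_sub_le hlam X
    have h2 : ∑ x, (((G.neighborFinset x ∩ X).card : ℝ) - t * X.card / n) ^ 2 =
        ∑ x, g x ^ 2 - 2 * (t * X.card / n) * ∑ x, g x + n * (t * X.card / n) ^ 2 := by
      rw [Finset.mul_sum, ← Finset.sum_sub_distrib]
      have : (n : ℝ) * (t * X.card / n) ^ 2 = ∑ _x : V, (t * X.card / n : ℝ) ^ 2 := by
        simp [h.card_eq]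
      rw [this, ← Finset.sum_add_distrib]
      exact Finset.sum_congr rfl fun x _ => by simp only [g]; ring
    rw [h2, hsum] at h1
    have h3 : -(2 * (t * X.card / n : ℝ) * (t * X.card)) + n * (t * X.card / n) ^ 2 =
        -(t ^ 2 * X.card ^ 2 / n) := by
      field_simp
      ring
    linarith
  have hcs : (∑ x ∈ N, g x) ^ 2 ≤ N.card * ∑ x ∈ N, g x ^ 2 := sq_sum_le_card_mul_sum_sq
  have hle : ∑ x ∈ N, g x ^ 2 ≤ ∑ x, g x ^ 2 :=
    Finset.sum_le_sum_of_subset_of_nonneg (Finset.subset_univ _) fun _ _ _ => sq_nonneg _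
  rw [hsupp, hsum] at hcs
  have h4 : (t * X.card : ℝ) ^ 2 ≤ N.card * (lam ^ 2 * X.card + t ^ 2 * X.card ^ 2 / n) :=
    hcs.trans (mul_le_mul_of_nonneg_left (hle.trans hsq) (Nat.cast_nonneg _))
  refine le_of_mul_le_mul_right ?_ hXpos
  calc (t : ℝ) ^ 2 * X.card * X.card = (t * X.card : ℝ) ^ 2 := by ring
    _ ≤ _ := h4
    _ = _ := by ring

end Spectral


/-! ### Closing the forbidden sets -/

/-- Forbidden sets can be slightly enlarged so that every vertex that is allowed for `u` has few
neighbours that are forbidden for a given neighbour of `u`. -/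
theorem SimpleGraph.exists_closed_forbidden {V W : Type*} [Fintype V] [DecidableEq V] [Fintype W]
    (G : SimpleGraph V) [DecidableRel G.Adj] (T : SimpleGraph W) [DecidableRel T.Adj]
    {q D : ℕ} {b s : ℝ} (B₀ : W → Finset V) (hdeg : ∀ w, T.degree w ≤ D)
    (hs : 0 ≤ s) (hB₀ : ∀ w, (B₀ w).card + D * s ≤ b)
    (hbad : ∀ B : Finset V, (B.card : ℝ) ≤ b →
      ((Finset.univ.filter fun x => q < (G.neighborFinset x ∩ B).card).card : ℝ) ≤ s) :
    ∃ B : W → Finset V, (∀ w, B₀ w ⊆ B w) ∧ (∀ w, ((B w).card : ℝ) ≤ b) ∧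
      ∀ w w', T.Adj w w' → ∀ x, x ∉ B w → (G.neighborFinset x ∩ B w').card ≤ q := by
  -- Sizes do not accumulate under iteration: `F` always restarts from `B₀` and adds at most `D` bad
  -- sets of size at most `s`, so it preserves the bound `b`.
  let F : (W → Finset V) → W → Finset V := fun B w =>
    B₀ w ∪ (T.neighborFinset w).biUnion fun w' =>
      Finset.univ.filter fun x => q < (G.neighborFinset x ∩ B w').card
  have hFmono : ∀ B B', B ≤ B' → F B ≤ F B' := by
    intro B B' hBB' w
    refine Finset.union_subset_union_right
      (Finset.biUnion_mono fun w' _ => Finset.monotone_filter_right _ fun x _ hx => ?_)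
    exact lt_of_lt_of_le hx (Finset.card_le_card (Finset.inter_subset_inter_left (hBB' w')))
  have hFcard : ∀ B : W → Finset V, (∀ w, ((B w).card : ℝ) ≤ b) →
      ∀ w, ((F B w).card : ℝ) ≤ b := by
    intro B hB w
    refine le_trans ?_ (hB₀ w)
    have h1 : ((F B w).card : ℝ) ≤ (B₀ w).card + ∑ w' ∈ T.neighborFinset w,
        ((Finset.univ.filter fun x => q < (G.neighborFinset x ∩ B w').card).card : ℝ) := by
      exact_mod_cast (Finset.card_union_le _ _).trans
        (Nat.add_le_add_left Finset.card_biUnion_le _)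
    have h2 := Finset.sum_le_card_nsmul (T.neighborFinset w) (fun w' =>
      ((Finset.univ.filter fun x => q < (G.neighborFinset x ∩ B w').card).card : ℝ)) s
      fun w' _ => hbad _ (hB w')
    rw [SimpleGraph.card_neighborFinset_eq_degree, nsmul_eq_mul] at h2
    have h3 : (T.degree w : ℝ) * s ≤ D * s :=
      mul_le_mul_of_nonneg_right (by exact_mod_cast hdeg w) hs
    linarith
  -- If `B` is in `P`, so is `F B`, which contains `B`; a maximal element is therefore closed under
  -- `F`.
  let P : Set (W → Finset V) := {B | B₀ ≤ B ∧ B ≤ F B ∧ ∀ w, ((B w).card : ℝ) ≤ b}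
  have hPne : P.Nonempty := by
    refine ⟨B₀, le_rfl, fun w => Finset.subset_union_left, fun w => le_trans ?_ (hB₀ w)⟩
    have : 0 ≤ (D : ℝ) * s := by positivity
    linarith
  obtain ⟨B, hB, hmax⟩ := (Set.toFinite P).exists_maximal hPne
  have hFB : F B ≤ B := hmax
    ⟨fun w => Finset.subset_union_left, hFmono _ _ hB.2.1, hFcard B hB.2.2⟩ hB.2.1
  refine ⟨B, hB.1, hB.2.2, fun w w' hww' x hx => ?_⟩
  by_contra! hlt
  exact hx (hFB w (Finset.mem_union_right _ (Finset.mem_biUnion.2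
    ⟨w', by simpa using hww', by simpa using hlt⟩)))

/-! ### Choice of constants and conclusion -/

theorem lemma5p4 (D : ℕ) :
    ∃ t : ℕ, 0 < t ∧ ∃ ε : ℝ, 0 < ε ∧
      ∀ (n : ℕ) (V : Type*) [Fintype V] [DecidableEq V] (G : SimpleGraph V) [DecidableRel G.Adj],
        G.IsNTLambda n t (3 * Real.sqrt (t : ℝ)) →
      ∀ (W : Type*) [Fintype W] (T : SimpleGraph W) [DecidableRel T.Adj],
        T.IsTree → (Fintype.card W : ℝ) ≤ (n : ℝ) / (3 * (t : ℝ)) → T.maxDegree ≤ D →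
      ∀ S : W → Finset V, (∀ v : W, (1 - ε) * (n : ℝ) ≤ ((S v).card : ℝ)) →
        ∃ φ : SimpleGraph.Copy T G, ∀ v : W, φ v ∈ S v := by
  -- Since `3168 = 18 * 176`, the at most `D` bad sets of size `18 * n / q` add at most `n / 176` to
  -- a forbidden set of size at most `n / 176`, giving `n / 88` in total.
  obtain ⟨q, hq⟩ : ∃ q : ℕ, q = 3168 * (D + 1) := ⟨_, rfl⟩
  have hqR : (q : ℝ) = 3168 * (D + 1) := by exact_mod_cast hq
  have hD0 : (0 : ℝ) ≤ D := Nat.cast_nonneg D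
  have hq0 : (0 : ℝ) < q := by linarith
  -- With `t = 44 * q`, the average degree into a set of size `n / 88` is at most `q / 2`, and the
  -- expansion factor `t / 11` equals `4 * q`.
  obtain ⟨t, ht⟩ : ∃ t : ℕ, t = 44 * q := ⟨_, rfl⟩
  have htR : (t : ℝ) = 44 * q := by exact_mod_cast ht
  have ht0 : (0 : ℝ) < t := by linarith
  refine ⟨t, by omega, 1 / 176, by norm_num, ?_⟩
  intro n V _ _ G _ hG W _ T _ hT hW hdeg S hS
  have hdeg' : ∀ w, T.degree w ≤ D := fun w => (T.degree_le_maxDegree w).trans hdeg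
  have hlam2 : (3 * Real.sqrt (t : ℝ)) ^ 2 = 9 * t := by
    rw [mul_pow, Real.sq_sqrt ht0.le]
    norm_num
  have hlam : 3 * Real.sqrt (t : ℝ) < t := by
    refine lt_of_pow_lt_pow_left₀ 2 ht0.le ?_
    rw [hlam2]
    nlinarith
  have := hT.connected.nonempty
  have hWpos : 0 < Fintype.card W := Fintype.card_pos
  rw [le_div_iff₀ (by positivity)] at hW
  have hW' : Fintype.card W * (3 * t) ≤ n := by exact_mod_cast hW
  have htpos : 0 < t := by omega
  have hn : 0 < n := lt_of_lt_of_le (by positivity) hW'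
  have hnR : (0 : ℝ) < n := by exact_mod_cast hn
  obtain ⟨m, hm⟩ : ∃ m : ℕ, m = n / t := ⟨_, rfl⟩
  have hWm : Fintype.card W ≤ m := by
    rw [hm, Nat.le_div_iff_mul_le htpos]
    exact (Nat.mul_le_mul_left _ (by omega)).trans hW'
  have hmt : (m : ℝ) * t ≤ n := by
    have := Nat.div_mul_le_self n t
    rw [← hm] at this
    exact_mod_cast this
  have hexp : ∀ X : Finset V, X.Nonempty → X.card ≤ 2 * m →
      4 * q * X.card ≤ (X.biUnion (G.neighborFinset ·)).card := by
    intro X hX hXm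
    have h1 := hG.card_mul_sq_le hn hlam hX
    rw [hlam2] at h1
    have hXm' : (X.card : ℝ) ≤ 2 * m := by exact_mod_cast hXm
    -- As `X.card ≤ 2 * n / t`, this term joins `9 * t` to give `11 * t`.
    have h2 : (t : ℝ) ^ 2 * X.card / n ≤ 2 * t := by
      rw [div_le_iff₀ hnR]
      nlinarith
    have h3 : (t : ℝ) * (t * X.card) ≤ t * ((X.biUnion (G.neighborFinset ·)).card * 11) := by
      calc (t : ℝ) * (t * X.card) = t ^ 2 * X.card := by ring
        _ ≤ _ := h1
        _ ≤ (X.biUnion (G.neighborFinset ·)).card * (9 * t + 2 * t : ℝ) :=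
          mul_le_mul_of_nonneg_left (by linarith) (Nat.cast_nonneg _)
        _ = _ := by ring
    have h4 := le_of_mul_le_mul_left h3 ht0
    rw [htR] at h4
    have h5 : (4 * q * X.card : ℝ) ≤ (X.biUnion (G.neighborFinset ·)).card := by linarith
    exact_mod_cast h5
  have hbad : ∀ B : Finset V, (B.card : ℝ) ≤ n / 88 →
      ((Finset.univ.filter fun x => q < (G.neighborFinset x ∩ B).card).card : ℝ) ≤
        18 * n / q := by
    intro B hB
    have h1 : (t : ℝ) * B.card / n ≤ q / 2 := by
      rw [div_le_iff₀ hnR, htR]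
      nlinarith
    have h2 := hG.card_filter_mul_sq_le hlam B (q := q) (d := q / 2) (by positivity) (by linarith)
    rw [hlam2, htR] at h2
    rw [le_div_iff₀ hq0]
    refine le_of_mul_le_mul_right ?_ (by positivity : (0 : ℝ) < q / 4)
    nlinarith
  obtain ⟨B, hSB, hBcard, hB⟩ := G.exists_closed_forbidden T (q := q) (D := D)
    (fun w => (S w)ᶜ) hdeg' (by positivity) (fun w => by
      have h1 := hS w
      have h2 : ((S w)ᶜ.card : ℝ) = n - (S w).card := by
        rw [Finset.card_compl, Nat.cast_sub (Finset.card_le_univ _), hG.card_eq]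
      have h3 : (D : ℝ) * (18 * n / q) ≤ n / 176 := by
        rw [← mul_div_assoc, div_le_iff₀ hq0, hqR]
        nlinarith
      rw [h2]
      linarith) hbad
  have hne : ∀ w, ∃ x, x ∉ B w := by
    intro w
    by_contra! hall
    have h1 := hBcard w
    rw [Finset.eq_univ_of_forall hall, Finset.card_univ, hG.card_eq] at h1
    linarith
  obtain ⟨k, hk⟩ : ∃ k, Fintype.card W = k + 1 := ⟨Fintype.card W - 1, by omega⟩
  -- Demands use at most half of the expansion `4 * q`; the rest covers the at most `m` occupied
  -- vertices once `X.card > m`.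
  have hKq : q + D ≤ 2 * q := by omega
  obtain ⟨φ, -, hinj, hhom, hlist, -⟩ := SimpleGraph.exists_extendable_embedding (G := G) (m := m)
    (q := q) (D := D) (M := m) (by omega)
    (fun X hX hXm => by
      have h1 := hexp X hX hXm
      have h2 := hX.card_pos
      have h3 := Nat.mul_le_mul_right X.card hKq
      have h4 : 1 ≤ q * X.card := Nat.mul_pos (by omega) h2
      linarith)
    (fun X hXm hXm' => by
      have h1 := hexp X (Finset.card_pos.1 (by omega)) hXm'
      have h3 := Nat.mul_le_mul_right X.card hKq
      have h4 : 1 * X.card ≤ q * X.card := Nat.mul_le_mul_right _ (by omega)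
      linarith) k W T B hk (by omega) hT hdeg' hne hB
  refine ⟨⟨⟨φ, fun {a b} hab => hhom a b hab⟩, hinj⟩, fun v => ?_⟩
  by_contra hv
  exact hlist v (hSB v (Finset.mem_compl.2 hv))
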